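/- Let $\delta,r>0$ and $0<\xi<1$. Let $f(x)=\frac12 x^\top Mx$ on $\mathbb R^d$, where $M$ is a symmetric matrix all of whose eigenvalues have absolute value at most $L$, and let $S=\{x\mid Ax\le 0\}$ be defined by $k$ linear inequalities $A_i^\top x\le 0$. Write $\mathcal B(r)$ for the closed ball of radius $r$ around $0$. Suppose that $0$ is a $(\delta,r)$-quadratic corner saddle point, i.e. $\min_{x\in S\cap\mathcal B(r)}f(x)<-\delta$. Consider the following algorithm with an iteration number $T$. For each subset $I\subseteq[k]$ (in any order), let $\mathcal A_I=\{x\mid A_i^\top x=0\text{ for all }i\in I\}$, draw an independent $\zeta\sim\mathcal N(0,\mathrm{Id})$, run the projected power method $$x_0=\mathrm{proj}_{\mathcal A_I}(\zeta),\qquad x_{t+1}=\mathrm{proj}_{\mathcal A_I}\Bigl(x_t-\tfrac1L\bigl(\nabla f(x_t)-\nabla f(0)\bigr)\Bigr)\quad(0\le t<T),$$ and put $e=r\,x_T/\|x_T\|$ (with $e=0$ if $x_T=0$). If $e\in S$ and $f(e)<f(0)-\frac\delta2$, return $e$; otherwise, if $-e\in S$ and $f(-e)<f(0)-\frac\delta2$,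 return $-e$; otherwise continue with the next subset. If no subset succeeds, report failure. There is an absolute constant $C$ such that, for a suitable $T$ depending only on $d,k,L,\delta,r,\xi$, the algorithm finds, with probability at least $1-\xi$, a point $x\in S\cap\mathcal B(r)$ with $f(x)<-\delta/2$ (in particular $f(x)<-\Omega(\delta)$), and it always makes at most $$C\cdot\frac{L\,r^2\,\max\{k,1\}\,2^k}{\delta}\,\log\frac{2d}{\xi}$$ calls to the (deterministic, exact) gradient oracle. -/

import Mathlib

noncomputable section

/-- The Euclidean space `ℝ^d`. -/
abbrev Euc (d : ℕ) : Type := EuclideanSpace ℝ (Fin d)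

/-! ### The optimization problem -/

/-- `λ_{|max|}(M)`: the largest absolute value of an eigenvalue of a symmetric real matrix. -/
def lambdaAbsMax {d : ℕ} {M : Matrix (Fin d) (Fin d) ℝ} (hM : M.IsHermitian) : ℝ :=
  ⨆ i, |hM.eigenvalues i|

/-- The quadratic objective `f(x) = ½ xᵀ M x`. -/
def quadForm {d : ℕ} (M : Matrix (Fin d) (Fin d) ℝ) (x : Euc d) : ℝ :=
  (1 / 2) * (x.ofLp ⬝ᵥ M.mulVec x.ofLp)

/-- The polyhedral cone `{y | A (y - x) ≤ 0}` with corner `x`; the rows of `A` are the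
constraints. -/
def cornerCone {d k : ℕ} (A : Matrix (Fin k) (Fin d) ℝ) (x : Euc d) : Set (Euc d) :=
  {y | ∀ i, A.mulVec (y - x).ofLp i ≤ 0}

/-- `0` is a `(δ, r)`-quadratic corner saddle point: the minimum of `f` over the intersection of
the closed ball `B(r)` with `S` is less than `-δ`. (For continuous `f` and closed `S ∋ 0` the minimum
is attained, so this says that some point there has value less than `-δ`.) -/
def IsQCSP {d : ℕ} (f : Euc d → ℝ) (S : Set (Euc d)) (δ r : ℝ) : Prop :=
  ∃ x ∈ Metric.closedBall (0 : Euc d) r ∩ S, f x < -δ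

/-! ### Programs with oracle access to the objective -/

/-- A program that accesses an unknown function `f : E → ℝ` only by adaptive queries
to a gradient oracle and to a value oracle, and finally returns an element of `α`. -/
inductive OracleProg (E α : Type) : Type
  /-- stop and return `a` -/
  | ret (a : α) : OracleProg E α
  /-- query `∇f(x)` and continue depending on the answer -/
  | grad (x : E) (next : E → OracleProg E α) : OracleProg E α
  /-- query `f(x)` and continue depending on the answer -/
  | value (x : E) (next : ℝ → OracleProg E α) : OracleProg E α

namespace OracleProg

/-- Sequential composition: run `p`, then run `q` on the result. -/
def bind {E α β : Type} (p : OracleProg E α) (q : α → OracleProg E β) : OracleProg E β :=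
  match p with
  | ret a => q a
  | grad x next => grad x fun g => (next g).bind q
  | value x next => value x fun v => (next v).bind q

/-- The result of a program when the oracles answer exactly with `∇f` and `f`. -/
def eval {d : ℕ} {α : Type} (f : Euc d → ℝ) : OracleProg (Euc d) α → α
  | ret a => a
  | grad x next => (next (gradient f x)).eval f
  | value x next => (next (f x)).eval f

/-- The number of gradient oracle calls that a program makes on `f`. -/
def gradCalls {d : ℕ} {α : Type} (f : Euc d → ℝ) : OracleProg (Euc d) α → ℕ
  | ret _ => 0
  | grad x next => (next (gradient f x)).gradCalls f + 1
  | value x next => (next (f x)).gradCalls f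

end OracleProg

/-! ### The algorithm -/

/-- The linear subspace `{v | A_iᵀ v = 0 for all i ∈ I}`. -/
def activeDirections {d k : ℕ} (A : Matrix (Fin k) (Fin d) ℝ) (I : Finset (Fin k)) :
    Submodule ℝ (Euc d) where
  carrier := {v | ∀ i ∈ I, A.mulVec v.ofLp i = 0}
  add_mem' := by
    intro a b ha hb i hi
    simp [Matrix.mulVec_add, ha i hi, hb i hi]
  zero_mem' := by
    intro i _
    simp
  smul_mem' := by
    intro c a ha i hi
    simp [Matrix.mulVec_smul, ha i hi]

/-- The affine subspace `{y | A_iᵀ (y - x) = 0 for all i ∈ I}`. -/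
abbrev activeSubspace {d k : ℕ} (A : Matrix (Fin k) (Fin d) ℝ) (x : Euc d)
    (I : Finset (Fin k)) : AffineSubspace ℝ (Euc d) :=
  AffineSubspace.mk' x (activeDirections A I)

/-- Euclidean projection onto a nonempty affine subspace. -/
def proj {d : ℕ} (𝒜 : AffineSubspace ℝ (Euc d)) [Nonempty 𝒜] (z : Euc d) : Euc d :=
  (EuclideanGeometry.orthogonalProjection 𝒜 z : Euc d)

/-- The loop of the projected power method: `T` steps
`z ← proj_𝒜 (z - η (∇f(z) - ∇f(x)))`. Both gradients are queried (and counted) in every step. -/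
def powerLoop {d : ℕ} (x : Euc d) (𝒜 : AffineSubspace ℝ (Euc d)) [Nonempty 𝒜] (η : ℝ) :
    ℕ → Euc d → OracleProg (Euc d) (Euc d)
  | 0, z => .ret z
  | T + 1, z => .grad z fun g => .grad x fun g₀ => powerLoop x 𝒜 η T (proj 𝒜 (z - η • (g - g₀)))

/-- The projected power method in `𝒜` started from `proj_𝒜 (x + noise)`. It returns
`e = r (x_T - x) / ‖x_T - x‖` (which is `0` if `x_T = x`). -/
def findInsideCorner {d : ℕ} (x : Euc d) (𝒜 : AffineSubspace ℝ (Euc d)) [Nonempty 𝒜]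
    (r η : ℝ) (T : ℕ) (noise : Euc d) : OracleProg (Euc d) (Euc d) :=
  (powerLoop x 𝒜 η T (proj 𝒜 (x + noise))).bind fun xT =>
    .ret ((r / ‖xT - x‖) • (xT - x))

open Classical in
/-- The exhaustive search over the sets `I` of constraints in a given list. For each `I`, the
projected power method is run in the affine subspace where the constraints from `I` are active,
with the initial noise `noise I`; the first candidate among `x + e`, `x - e` that lies in the cone
and improves the value by more than `δ / 2` is returned. The result `none` is failure. -/
def houdiniEscapeCorner {d k : ℕ} (x : Euc d) (A : Matrix (Fin k) (Fin d) ℝ) (δ r η : ℝ) (T : ℕ)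
    (noise : Finset (Fin k) → Euc d) :
    List (Finset (Fin k)) → OracleProg (Euc d) (Option (Euc d))
  | [] => .ret none
  | I :: rest =>
    (findInsideCorner x (activeSubspace A x I) r η T (noise I)).bind fun e =>
      .value x fun fx =>
        .value (x + e) fun fPlus =>
          if x + e ∈ cornerCone A x ∧ fPlus < fx - δ / 2 then .ret (some (x + e))
          else .value (x - e) fun fMinus =>
            if x - e ∈ cornerCone A x ∧ fMinus < fx - δ / 2 then .ret (some (x - e))
            else houdiniEscapeCorner x A δ r η T noise rest

/-- The law of the randomness of the algorithm: independent standard Gaussian vectors in `ℝ^d`,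
one for each set of constraints. -/
def noiseLaw (d k : ℕ) : MeasureTheory.Measure (Finset (Fin k) → Euc d) :=
  MeasureTheory.Measure.pi fun _ => ProbabilityTheory.stdGaussian (Euc d)

end

/-!
Call a point of the cone `S` good for `J` if it lies in `𝒜_J` and its normalised value
`f(x) / ‖x‖²` is sufficiently negative, with a demand that relaxes slightly as `J` grows, and let
`J` be maximal among the sets that have a good point. If `e ∈ 𝒜_J` has nearly as small a value and
neither `e` nor `-e` lies in `S`, then the segment from the good point to one of `±e` leaves `S`
through a further facet at a point that is good for the enlarged set, contradicting maximality. So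
on this one face, fixed before the noise is drawn, any good enough iterate succeeds up to sign.

There the method is the power iteration of the positive operator `P (1 - M / L) P`. The moments
`⟪B ^ j z, z⟫` of a positive operator `B` are log-convex, so the Rayleigh quotient of `B ^ T z` is
nearly the top eigenvalue as soon as `z` is not almost orthogonal to a top eigenvector, and Gaussian
noise is almost orthogonal to a fixed unit vector only with small probability.
-/

open MeasureTheory ProbabilityTheory
open scoped RealInnerProductSpace

section PowerIteration

theorem le_ratio_pow_mul_of_logConvex {a : ℕ → ℝ} (hpos : ∀ j, 0 < a j)
    (hconv : ∀ j, a (j + 1) ^ 2 ≤ a j * a (j + 2)) (n : ℕ) :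
    a n ≤ (a (n + 1) / a n) ^ n * a 0 := by
  have hmono : Monotone fun j => a (j + 1) / a j := by
    refine monotone_nat_of_le_succ fun j => ?_
    rw [div_le_div_iff₀ (hpos _) (hpos _), ← sq, mul_comm]
    exact hconv j
  have hprod : ∏ j ∈ Finset.range n, a (j + 1) / a j = a n / a 0 :=
    Finset.prod_range_induction _ (fun j => a j / a 0) (div_self (hpos 0).ne') n fun j _ => by
      rw [div_mul_div_comm, mul_comm, mul_div_mul_right _ _ (hpos j).ne']
  rw [← div_le_iff₀ (hpos 0), ← hprod]
  refine (Finset.prod_le_prod (fun j _ => (div_pos (hpos _) (hpos _)).le) fun j hj =>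
    hmono (Finset.mem_range.1 hj).le).trans_eq ?_
  rw [Finset.prod_const, Finset.card_range]

variable {E : Type*} [NormedAddCommGroup E] [InnerProductSpace ℝ E] {T : E →ₗ[ℝ] E}

theorem inner_pow_add_apply (hT : T.IsSymmetric) (i j : ℕ) (x y : E) :
    ⟪(T ^ (i + j)) x, y⟫ = ⟪(T ^ i) x, (T ^ j) y⟫ := by
  rw [add_comm, pow_add, Module.End.mul_apply, hT.pow j]

theorem inner_pow_apply_self_nonneg (hT : T.IsPositive) (j : ℕ) (x : E) :
    0 ≤ ⟪(T ^ j) x, x⟫ := by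
  obtain ⟨i, rfl | rfl⟩ := j.even_or_odd'
  · rw [two_mul, inner_pow_add_apply hT.isSymmetric]
    exact real_inner_self_nonneg
  · rw [two_mul, add_right_comm, inner_pow_add_apply hT.isSymmetric, pow_succ']
    exact hT.re_inner_nonneg_left _

theorem inner_pow_apply_sq_le (hT : T.IsPositive) (j : ℕ) (x y : E) :
    ⟪(T ^ j) x, y⟫ ^ 2 ≤ ⟪(T ^ j) x, x⟫ * ⟪(T ^ j) y, y⟫ := by
  refine LinearMap.BilinForm.apply_sq_le_of_symm ((innerₗ E).comp (T ^ j))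
    (inner_pow_apply_self_nonneg hT j) ⟨fun v w => ?_⟩ x y
  exact (hT.isSymmetric.pow j v w).trans (real_inner_comm _ _)

theorem inner_pow_apply_self_logConvex (hT : T.IsPositive) (j : ℕ) (x : E) :
    ⟪(T ^ (j + 1)) x, x⟫ ^ 2 ≤ ⟪(T ^ j) x, x⟫ * ⟪(T ^ (j + 2)) x, x⟫ := by
  have hshift : ⟪(T ^ j) (T x), T x⟫ = ⟪(T ^ (j + 2)) x, x⟫ := by
    rw [← Module.End.mul_apply, ← pow_succ, inner_pow_add_apply hT.isSymmetric (j + 1) 1, pow_one]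
  rw [inner_pow_add_apply hT.isSymmetric, pow_one, ← hshift]
  exact inner_pow_apply_sq_le hT j x (T x)

theorem pow_eigenvalue_mul_inner_sq_le (hT : T.IsPositive) {μ : ℝ} (hμ : 0 < μ) {u : E}
    (hu : T u = μ • u) (hu1 : ‖u‖ = 1) (j : ℕ) (x : E) :
    μ ^ j * ⟪u, x⟫ ^ 2 ≤ ⟪(T ^ j) x, x⟫ := by
  have hpow : (T ^ j) u = μ ^ j • u := by
    induction j with
    | zero => simp
    | succ j ih => rw [pow_succ', Module.End.mul_apply, ih, map_smul, hu, smul_smul, pow_succ]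
  have hcs := inner_pow_apply_sq_le hT j u x
  rw [hpow, real_inner_smul_left, real_inner_smul_left, real_inner_self_eq_norm_sq, hu1, one_pow,
    mul_one, mul_pow, sq, mul_assoc] at hcs
  exact le_of_mul_le_mul_left hcs (pow_pos hμ j)

theorem mul_exp_neg_le_of_pow_mul_exp_neg_le {μ ρ Λ : ℝ} {n : ℕ} (hn : n ≠ 0) (hρ : 0 ≤ ρ)
    (h : μ ^ n * Real.exp (-Λ) ≤ ρ ^ n) : μ * Real.exp (-(Λ / n)) ≤ ρ := by
  refine le_of_pow_le_pow_left₀ hn hρ ?_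
  rwa [mul_pow, ← Real.exp_nat_mul, mul_neg, mul_div_cancel₀ _ (Nat.cast_ne_zero.2 hn)]

-- The moments `⟪T ^ j z, z⟫` are log-convex, so their `2 n`-th successive ratio, which is the
-- Rayleigh quotient of `T ^ n z`, dominates the geometric mean of the previous ones.
theorem rayleigh_power_iterate_ge (hT : T.IsPositive) {u z : E} {μ Λ : ℝ} (hμ : 0 < μ)
    (hu : T u = μ • u) (hu1 : ‖u‖ = 1) (hz : Real.exp (-Λ) * ‖z‖ ^ 2 < ⟪u, z⟫ ^ 2) {n : ℕ}
    (hn : n ≠ 0) :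
    (T ^ n) z ≠ 0 ∧
      μ * (1 - Λ / (2 * n)) * ‖(T ^ n) z‖ ^ 2 ≤ ⟪T ((T ^ n) z), (T ^ n) z⟫ := by
  set a : ℕ → ℝ := fun j => ⟪(T ^ j) z, z⟫ with ha
  have hlow : ∀ j, μ ^ j * ⟪u, z⟫ ^ 2 ≤ a j := fun j =>
    pow_eigenvalue_mul_inner_sq_le hT hμ hu hu1 j z
  have huz : 0 < ⟪u, z⟫ ^ 2 := lt_of_le_of_lt (by positivity) hz
  have hpos : ∀ j, 0 < a j := fun j => (mul_pos (pow_pos hμ j) huz).trans_le (hlow j)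
  have heven : a (2 * n) = ‖(T ^ n) z‖ ^ 2 := by
    rw [ha, two_mul, ← real_inner_self_eq_norm_sq]
    exact inner_pow_add_apply hT.isSymmetric n n z z
  have hodd : a (2 * n + 1) = ⟪T ((T ^ n) z), (T ^ n) z⟫ := by
    rw [← Module.End.mul_apply, ← pow_succ', ← inner_pow_add_apply hT.isSymmetric,
      add_right_comm, ← two_mul]
  refine ⟨fun h0 => (hpos (2 * n)).ne' (by simp [heven, h0]), ?_⟩
  rw [← heven, ← hodd, ← le_div_iff₀ (hpos _)]
  have hratio : μ ^ (2 * n) * Real.exp (-Λ) ≤ (a (2 * n + 1) / a (2 * n)) ^ (2 * n) := by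
    refine le_of_mul_le_mul_right ?_ (hpos 0)
    calc μ ^ (2 * n) * Real.exp (-Λ) * a 0
        = μ ^ (2 * n) * (Real.exp (-Λ) * ‖z‖ ^ 2) := by simp [ha, mul_assoc]
      _ ≤ μ ^ (2 * n) * ⟪u, z⟫ ^ 2 := by gcongr
      _ ≤ a (2 * n) := hlow _
      _ ≤ _ := le_ratio_pow_mul_of_logConvex hpos
          (fun j => inner_pow_apply_self_logConvex hT j z) _
  calc μ * (1 - Λ / (2 * n)) ≤ μ * Real.exp (-(Λ / (2 * n : ℕ))) := by
        push_cast
        gcongr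
        exact Real.one_sub_le_exp_neg _
    _ ≤ _ := mul_exp_neg_le_of_pow_mul_exp_neg_le (by lia) (div_pos (hpos _) (hpos _)).le hratio

theorem exists_unit_eigenvector_forall_inner_le [FiniteDimensional ℝ E] [Nontrivial E]
    (hT : T.IsSymmetric) :
    ∃ (μ : ℝ) (u : E), ‖u‖ = 1 ∧ T u = μ • u ∧ ∀ x, ⟪T x, x⟫ ≤ μ * ‖x‖ ^ 2 := by
  obtain ⟨v, hv⟩ := hT.hasEigenvalue_iSup_of_finiteDimensional.exists_hasEigenvector
  refine ⟨⨆ y : {y : E // y ≠ 0}, RCLike.re ⟪T y, y⟫ / ‖(y : E)‖ ^ 2, ‖v‖⁻¹ • v,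
    norm_smul_inv_norm hv.2, ?_, fun x => ?_⟩
  · rw [map_smul, hv.apply_eq_smul, smul_comm]
    rfl
  · rcases eq_or_ne x 0 with rfl | hx
    · simp
    rw [← div_le_iff₀ (by positivity)]
    refine le_ciSup (f := fun y : {y : E // y ≠ 0} => RCLike.re ⟪T y, y⟫ / ‖(y : E)‖ ^ 2)
      ⟨‖LinearMap.toContinuousLinearMap T‖, ?_⟩ ⟨x, hx⟩
    rintro _ ⟨y, rfl⟩
    exact (le_abs_self _).trans
      (ContinuousLinearMap.rayleighQuotient_le_norm (LinearMap.toContinuousLinearMap T) y)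

end PowerIteration

section ProjectedPowerMethod

variable {E : Type*} [NormedAddCommGroup E] [InnerProductSpace ℝ E]

/-- The step `x ↦ P (x - η m x)` of the projected power method in the subspace `V`, where `P` is the
orthogonal projection onto `V`. Projecting the argument as well changes nothing on `V` and makes the
map symmetric. -/
noncomputable def projectedStep (m : E →ₗ[ℝ] E) (η : ℝ) (V : Submodule ℝ E)
    [V.HasOrthogonalProjection] : E →ₗ[ℝ] E :=
  V.starProjection.toLinearMap ∘ₗ (1 - η • m) ∘ₗ V.starProjection.toLinearMap

variable {m : E →ₗ[ℝ] E} {η : ℝ} {V : Submodule ℝ E} [V.HasOrthogonalProjection]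

theorem projectedStep_apply_of_mem {x : E} (hx : x ∈ V) :
    projectedStep m η V x = V.starProjection (x - η • m x) := by
  simp [projectedStep, Submodule.starProjection_eq_self_iff.2 hx]

theorem projectedStep_apply_mem (x : E) : projectedStep m η V x ∈ V :=
  V.starProjection_apply_mem _

theorem projectedStep_pow_mem (n : ℕ) {x : E} (hx : x ∈ V) : (projectedStep m η V ^ n) x ∈ V := by
  cases n with
  | zero => exact hx
  | succ n =>
    rw [pow_succ', Module.End.mul_apply]
    exact projectedStep_apply_mem _

theorem inner_projectedStep_apply (x y : E) :
    ⟪projectedStep m η V x, y⟫ =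
      ⟪V.starProjection x, V.starProjection y⟫ -
        η * ⟪m (V.starProjection x), V.starProjection y⟫ := by
  simp [projectedStep, V.inner_starProjection_left_eq_right, inner_sub_left, real_inner_smul_left]

theorem inner_projectedStep_apply_self_of_mem {x : E} (hx : x ∈ V) :
    ⟪projectedStep m η V x, x⟫ = ‖x‖ ^ 2 - η * ⟪m x, x⟫ := by
  rw [inner_projectedStep_apply, Submodule.starProjection_eq_self_iff.2 hx,
    real_inner_self_eq_norm_sq]

theorem projectedStep_isPositive (hm : m.IsSymmetric) {L : ℝ} (hL : 0 < L)
    (hmL : ∀ x, ⟪m x, x⟫ ≤ L * ‖x‖ ^ 2) : (projectedStep m (1 / L) V).IsPositive := by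
  refine ⟨fun x y => ?_, fun x => ?_⟩
  · rw [inner_projectedStep_apply, real_inner_comm (projectedStep m _ V y) x,
      inner_projectedStep_apply, hm, real_inner_comm (V.starProjection x),
      real_inner_comm (V.starProjection x)]
  · have h := hmL (V.starProjection x)
    rw [← div_le_iff₀' hL] at h
    simp only [RCLike.re_to_real, inner_projectedStep_apply, real_inner_self_eq_norm_sq]
    linarith [one_div_mul_eq_div L ⟪m (V.starProjection x), V.starProjection x⟫]

theorem exists_unit_eigenvector_projectedStep [FiniteDimensional ℝ E] (hm : m.IsSymmetric) {L : ℝ}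
    (hL : 0 < L) (hmL : ∀ x, |⟪m x, x⟫| ≤ L * ‖x‖ ^ 2) {c : ℝ} (hc : c ≤ L) {x : E} (hxV : x ∈ V)
    (hx : ⟪m x, x⟫ < c * ‖x‖ ^ 2) :
    ∃ μ : ℝ, ∃ u ∈ V, ‖u‖ = 1 ∧ projectedStep m (1 / L) V u = μ • u ∧
      1 - c / L < μ ∧ μ ≤ 2 := by
  set B := projectedStep m (1 / L) V with hB
  have hBpos : B.IsPositive := projectedStep_isPositive hm hL fun y => (le_abs_self _).trans (hmL y)
  have : Nontrivial E := nontrivial_of_ne x 0 (by rintro rfl; simp at hx)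
  obtain ⟨μ, u, hu1, hu, hμ⟩ := exists_unit_eigenvector_forall_inner_le hBpos.isSymmetric
  have hμc : 1 - c / L < μ := by
    refine lt_of_mul_lt_mul_right ?_ (sq_nonneg ‖x‖)
    calc (1 - c / L) * ‖x‖ ^ 2 = ‖x‖ ^ 2 - 1 / L * (c * ‖x‖ ^ 2) := by ring
      _ < ‖x‖ ^ 2 - 1 / L * ⟪m x, x⟫ := by gcongr
      _ = ⟪B x, x⟫ := (inner_projectedStep_apply_self_of_mem hxV).symm
      _ ≤ μ * ‖x‖ ^ 2 := hμ x
  have hμ0 : 0 < μ := (sub_nonneg.2 ((div_le_one hL).2 hc)).trans_lt hμc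
  have huV : u ∈ V := by
    rw [← inv_smul_smul₀ hμ0.ne' u, ← hu]
    exact V.smul_mem _ (projectedStep_apply_mem _)
  refine ⟨μ, u, huV, hu1, hu, hμc, ?_⟩
  calc μ = ⟪B u, u⟫ := by rw [hu, real_inner_smul_left, real_inner_self_eq_norm_sq, hu1]; simp
    _ = 1 - 1 / L * ⟪m u, u⟫ := by rw [hB, inner_projectedStep_apply_self_of_mem huV, hu1, one_pow]
    _ ≤ 1 - 1 / L * -(L * ‖u‖ ^ 2) := by gcongr; exact neg_le_of_abs_le (hmL u)
    _ = 2 := by rw [hu1]; field_simp; norm_num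

theorem exists_unit_forall_inner_projectedStep_pow_lt [FiniteDimensional ℝ E]
    (hm : m.IsSymmetric) {L : ℝ} (hL : 0 < L) (hmL : ∀ x, |⟪m x, x⟫| ≤ L * ‖x‖ ^ 2) {c : ℝ}
    (hc : c ≤ L) {x : E} (hxV : x ∈ V) (hx : ⟪m x, x⟫ < c * ‖x‖ ^ 2) {Λ : ℝ} (hΛ : 0 ≤ Λ) {n : ℕ}
    (hn : n ≠ 0) :
    ∃ u : E, ‖u‖ = 1 ∧ ∀ z, Real.exp (-Λ) * ‖z‖ ^ 2 < ⟪u, z⟫ ^ 2 →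
      ⟪m ((projectedStep m (1 / L) V ^ n) (V.starProjection z)),
          (projectedStep m (1 / L) V ^ n) (V.starProjection z)⟫ <
        (c + L * Λ / n) * ‖(projectedStep m (1 / L) V ^ n) (V.starProjection z)‖ ^ 2 := by
  obtain ⟨μ, u, huV, hu1, hu, hμc, hμ2⟩ := exists_unit_eigenvector_projectedStep hm hL hmL hc hxV hx
  have hμ0 : 0 < μ := (sub_nonneg.2 ((div_le_one hL).2 hc)).trans_lt hμc
  refine ⟨u, hu1, fun z hz => ?_⟩
  have hPz : Real.exp (-Λ) * ‖V.starProjection z‖ ^ 2 < ⟪u, V.starProjection z⟫ ^ 2 := by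
    rw [← V.inner_starProjection_left_eq_right, Submodule.starProjection_eq_self_iff.2 huV]
    refine lt_of_le_of_lt ?_ hz
    gcongr
    exact V.norm_starProjection_apply_le z
  obtain ⟨hw0, hw⟩ := rayleigh_power_iterate_ge
    (projectedStep_isPositive hm hL fun y => (le_abs_self _).trans (hmL y)) hμ0 hu hu1 hPz hn
  have hwV := projectedStep_pow_mem (m := m) (η := 1 / L) n (V.starProjection_apply_mem z)
  rw [inner_projectedStep_apply_self_of_mem hwV] at hw
  set w := (projectedStep m (1 / L) V ^ n) (V.starProjection z)
  have hrate : 1 - μ * (1 - Λ / (2 * n)) < c / L + Λ / n := by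
    have hloss : μ * (Λ / (2 * n)) ≤ 2 * (Λ / (2 * n)) := by gcongr
    have hhalf : 2 * (Λ / (2 * n)) = Λ / n := by field_simp
    linarith
  calc ⟪m w, w⟫ = L * (‖w‖ ^ 2 - (‖w‖ ^ 2 - 1 / L * ⟪m w, w⟫)) := by field_simp; ring
    _ ≤ L * (‖w‖ ^ 2 - μ * (1 - Λ / (2 * n)) * ‖w‖ ^ 2) := by gcongr
    _ = L * (1 - μ * (1 - Λ / (2 * n))) * ‖w‖ ^ 2 := by ring
    _ < L * (c / L + Λ / n) * ‖w‖ ^ 2 := by gcongr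
    _ = (c + L * Λ / n) * ‖w‖ ^ 2 := by field_simp

end ProjectedPowerMethod

section Gaussian

theorem gaussianPDFReal_le_inv_sqrt (m : ℝ) (v : NNReal) (x : ℝ) :
    gaussianPDFReal m v x ≤ (√(2 * Real.pi * v))⁻¹ := by
  refine mul_le_of_le_one_right (by positivity) (Real.exp_le_one_iff.2 ?_)
  rw [neg_div]
  exact neg_nonpos.2 (by positivity)

theorem gaussianReal_apply_le (m : ℝ) {v : NNReal} (hv : v ≠ 0) (s : Set ℝ) :
    gaussianReal m v s ≤ ENNReal.ofReal (√(2 * Real.pi * v))⁻¹ * volume s := by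
  rw [gaussianReal_apply m hv, ← setLIntegral_const]
  exact lintegral_mono fun x => ENNReal.ofReal_le_ofReal (gaussianPDFReal_le_inv_sqrt m v x)

variable {E : Type*} [NormedAddCommGroup E] [InnerProductSpace ℝ E] [FiniteDimensional ℝ E]
  [MeasurableSpace E] [BorelSpace E]

theorem stdGaussian_map_inner (u : E) :
    (stdGaussian E).map (fun x => ⟪u, x⟫) = gaussianReal 0 (‖u‖ ^ 2).toNNReal := by
  have h := IsGaussian.map_eq_gaussianReal (μ := stdGaussian E) (innerSL ℝ u)
  rwa [integral_strongDual_stdGaussian, variance_dual_stdGaussian, innerSL_apply_norm] at h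

theorem stdGaussian_abs_inner_le {u : E} (hu : ‖u‖ = 1) (a : ℝ) :
    stdGaussian E {x | |⟪u, x⟫| ≤ a} ≤ ENNReal.ofReal a := by
  have hpre : {x | |⟪u, x⟫| ≤ a} = (fun x => ⟪u, x⟫) ⁻¹' Set.Icc (-a) a := by
    ext x
    exact abs_le (G := ℝ)
  have hdensity : (√(2 * Real.pi * ((1 : NNReal) : ℝ)))⁻¹ ≤ 1 / 2 := by
    rw [one_div]
    refine inv_anti₀ two_pos (Real.le_sqrt_of_sq_le ?_)
    push_cast
    linarith [Real.pi_gt_three]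
  rw [hpre, ← Measure.map_apply (by fun_prop) measurableSet_Icc, stdGaussian_map_inner, hu,
    one_pow, Real.toNNReal_one]
  calc gaussianReal 0 1 (Set.Icc (-a) a)
      ≤ ENNReal.ofReal (√(2 * Real.pi * ((1 : NNReal) : ℝ)))⁻¹ * volume (Set.Icc (-a) a) :=
        gaussianReal_apply_le 0 one_ne_zero _
    _ ≤ ENNReal.ofReal (1 / 2) * volume (Set.Icc (-a) a) := by gcongr
    _ = ENNReal.ofReal a := by
      rw [Real.volume_Icc, ← ENNReal.ofReal_mul (by norm_num)]
      congr 1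
      ring

theorem lintegral_inner_sq_stdGaussian (u : E) :
    ∫⁻ x, ENNReal.ofReal (⟪u, x⟫ ^ 2) ∂(stdGaussian E) = ENNReal.ofReal (‖u‖ ^ 2) := by
  have h := evariance_eq_lintegral_ofReal (innerSL ℝ u) (stdGaussian E)
  rw [← (IsGaussian.memLp_dual (stdGaussian E) (innerSL ℝ u) 2 (by simp)).ofReal_variance_eq,
    variance_dual_stdGaussian, integral_strongDual_stdGaussian, innerSL_apply_norm] at h
  simpa only [sub_zero, innerSL_apply_apply] using h.symm

theorem lintegral_norm_sq_stdGaussian :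
    ∫⁻ x, ENNReal.ofReal (‖x‖ ^ 2) ∂(stdGaussian E) = Module.finrank ℝ E := by
  have h : ∀ x : E, ENNReal.ofReal (‖x‖ ^ 2) =
      ∑ i, ENNReal.ofReal (⟪stdOrthonormalBasis ℝ E i, x⟫ ^ 2) := fun x => by
    rw [← ENNReal.ofReal_sum_of_nonneg fun _ _ => sq_nonneg _,
      (stdOrthonormalBasis ℝ E).sum_sq_inner_right]
  simp_rw [h]
  rw [lintegral_finsetSum _ fun i _ => by fun_prop]
  simp [lintegral_inner_sq_stdGaussian]

theorem stdGaussian_norm_sq_ge_le {b : ℝ} (hb : 0 < b) :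
    stdGaussian E {x | b ≤ ‖x‖ ^ 2} ≤ ENNReal.ofReal (Module.finrank ℝ E / b) := by
  rw [ENNReal.ofReal_div_of_pos hb, ENNReal.ofReal_natCast, ← lintegral_norm_sq_stdGaussian]
  refine (measure_mono fun x hx => ?_).trans (meas_ge_le_lintegral_div (by fun_prop)
    (ENNReal.ofReal_pos.2 hb).ne' ENNReal.ofReal_ne_top)
  exact ENNReal.ofReal_le_ofReal hx

theorem le_stdGaussian_mul_norm_sq_lt_inner_sq {u : E} (hu : ‖u‖ = 1) {ξ : ℝ} (hξ : 0 < ξ) :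
    ENNReal.ofReal (1 - ξ) ≤
      stdGaussian E {x | ξ ^ 3 / (8 * Module.finrank ℝ E) * ‖x‖ ^ 2 < ⟪u, x⟫ ^ 2} := by
  have hd : (0 : ℝ) < Module.finrank ℝ E := by
    have : Nontrivial E := nontrivial_of_ne u 0 (norm_ne_zero_iff.1 (by simp [hu]))
    exact_mod_cast Module.finrank_pos (R := ℝ)
  set d : ℝ := (Module.finrank ℝ E : ℝ)
  set good := {x : E | ξ ^ 3 / (8 * d) * ‖x‖ ^ 2 < ⟪u, x⟫ ^ 2}
  set thin := {x : E | |⟪u, x⟫| ≤ ξ / 2}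
  set long := {x : E | 2 * d / ξ ≤ ‖x‖ ^ 2}
  have hcover : Set.univ ⊆ good ∪ (thin ∪ long) := fun x _ => by
    refine or_iff_not_imp_right.2 fun hx => ?_
    obtain ⟨hthin, hlong⟩ := not_or.1 hx
    calc ξ ^ 3 / (8 * d) * ‖x‖ ^ 2 ≤ ξ ^ 3 / (8 * d) * (2 * d / ξ) := by
          gcongr
          exact (not_le.1 hlong).le
      _ = (ξ / 2) ^ 2 := by field_simp; norm_num
      _ < |⟪u, x⟫| ^ 2 := by gcongr; exact not_le.1 hthin
      _ = ⟪u, x⟫ ^ 2 := sq_abs _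
  have hbad : stdGaussian E (thin ∪ long) ≤ ENNReal.ofReal ξ :=
    calc stdGaussian E (thin ∪ long)
        ≤ ENNReal.ofReal (ξ / 2) + ENNReal.ofReal (d / (2 * d / ξ)) :=
          (measure_union_le _ _).trans (add_le_add (stdGaussian_abs_inner_le hu _)
            (stdGaussian_norm_sq_ge_le (by positivity)))
      _ = ENNReal.ofReal ξ := by
          rw [← ENNReal.ofReal_add (by positivity) (by positivity)]
          congr 1
          field_simp
          norm_num
  rw [ENNReal.ofReal_sub _ hξ.le, ENNReal.ofReal_one, tsub_le_iff_right,
    ← measure_univ (μ := stdGaussian E)]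
  exact (measure_mono hcover).trans ((measure_union_le _ _).trans (by gcongr))

end Gaussian

section ConeFaces

variable {𝕜 E ι : Type*} [Field 𝕜] [LinearOrder 𝕜] [IsStrictOrderedRing 𝕜] [AddCommGroup E]
  [Module 𝕜 E] {φ : ι → E →ₗ[𝕜] 𝕜} {x w : E}

theorem exists_mem_segment_facet [Finite ι] (hx : ∀ i, φ i x ≤ 0) (hw : ∃ i, 0 < φ i w) :
    ∃ y ∈ segment 𝕜 x w, (∀ i, φ i y ≤ 0) ∧ ∃ i, 0 < φ i w ∧ φ i y = 0 := by
  set s : ι → 𝕜 := fun i => -φ i x / (φ i w - φ i x) with hs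
  have hden : ∀ {i}, 0 < φ i w → 0 < φ i w - φ i x := fun {i} hi =>
    sub_pos.2 ((hx i).trans_lt hi)
  obtain ⟨i, hi, hmin⟩ := Set.exists_min_image {i | 0 < φ i w} s (Set.toFinite _) hw
  have hs0 : 0 ≤ s i := div_nonneg (neg_nonneg.2 (hx i)) (hden hi).le
  have hs1 : s i ≤ 1 := (div_le_one (hden hi)).2 (by linarith [Set.mem_ofPred.1 hi])
  refine ⟨(1 - s i) • x + s i • w, ⟨1 - s i, s i, sub_nonneg.2 hs1, hs0, by ring, rfl⟩,
    fun j => ?_, i, hi, ?_⟩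
  · simp only [map_add, map_smul, smul_eq_mul]
    rcases lt_or_ge 0 (φ j w) with hj | hj
    · have h := hmin j hj
      rw [hs, le_div_iff₀ (hden hj)] at h
      linarith
    · exact add_nonpos (mul_nonpos_of_nonneg_of_nonpos (sub_nonneg.2 hs1) (hx j))
        (mul_nonpos_of_nonneg_of_nonpos hs0 hj)
  · simp only [map_add, map_smul, smul_eq_mul, hs]
    field_simp [(hden hi).ne']
    ring

theorem neg_of_mem_segment_of_polar_nonpos {Q : QuadraticForm 𝕜 E} (hx : Q x < 0) (hw : Q w < 0)
    (hpolar : QuadraticMap.polar Q x w ≤ 0) {y : E} (hy : y ∈ segment 𝕜 x w) : Q y < 0 := by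
  obtain ⟨a, b, ha, hb, hab, rfl⟩ := hy
  have hexpand : Q (a • x + b • w) =
      a * a * Q x + b * b * Q w + a * b * QuadraticMap.polar Q x w := by
    rw [QuadraticMap.map_add Q, QuadraticMap.map_smul, QuadraticMap.map_smul,
      QuadraticMap.polar_smul_left, QuadraticMap.polar_smul_right]
    simp only [smul_eq_mul, mul_assoc]
  have hcross := mul_nonpos_of_nonneg_of_nonpos (mul_nonneg ha hb) hpolar
  rw [hexpand]
  rcases ha.eq_or_lt with rfl | ha
  · simpa [(zero_add b).symm.trans hab] using hw
  · linarith [mul_neg_of_pos_of_neg (mul_pos ha ha) hx,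
      mul_nonpos_of_nonneg_of_nonpos (mul_self_nonneg b) hw.le]

-- Of two vectors `±e` outside the cone, take the one whose polar form with the cone point `y` is
-- nonpositive: then `q` stays negative on the segment from `y` to it.
theorem exists_maximal_face [Finite ι] {q : ℕ → QuadraticForm 𝕜 E} (hq : ∀ n v, q (n + 1) v ≤ q n v)
    (hx : ∀ i, φ i x ≤ 0) (hqx : q 0 x < 0) :
    ∃ J : Finset ι, (∃ y, (∀ i ∈ J, φ i y = 0) ∧ q J.card y < 0) ∧
      ∀ e, (∀ i ∈ J, φ i e = 0) → q (J.card + 1) e < 0 →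
        (∀ i, φ i e ≤ 0) ∨ ∀ i, φ i (-e) ≤ 0 := by
  classical
  obtain ⟨J, ⟨y, hy, hyJ, hqy⟩, hmax⟩ := Set.Finite.exists_maximal
    (s := {J : Finset ι | ∃ y, (∀ i, φ i y ≤ 0) ∧ (∀ i ∈ J, φ i y = 0) ∧ q J.card y < 0})
    (Set.toFinite _) ⟨∅, x, hx, by simp, hqx⟩
  refine ⟨J, ⟨y, hyJ, hqy⟩, fun e heJ hqe => ?_⟩
  by_contra! hout
  have hface : ∀ w, (∀ i ∈ J, φ i w = 0) → q (J.card + 1) w < 0 →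
      QuadraticMap.polar (q (J.card + 1)) y w ≤ 0 → ∀ i, φ i w ≤ 0 := by
    intro w hwJ hqw hpolar
    by_contra! hw
    obtain ⟨z, hz, hzcone, i, hi, hzi⟩ := exists_mem_segment_facet hy hw
    have hiJ : i ∉ J := fun h => hi.ne' (hwJ i h)
    have hzJ : ∀ j ∈ J, φ j z = 0 := fun j hj => by
      obtain ⟨a, b, -, -, -, rfl⟩ := hz
      simp [hyJ j hj, hwJ j hj]
    refine hiJ (hmax ⟨z, hzcone, ?_, ?_⟩ (Finset.subset_insert i J) (Finset.mem_insert_self i J))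
    · exact Finset.forall_mem_insert _ _ _ |>.2 ⟨hzi, hzJ⟩
    · rw [Finset.card_insert_of_notMem hiJ]
      exact neg_of_mem_segment_of_polar_nonpos ((hq _ _).trans_lt hqy) hqw hpolar hz
  rcases le_total (QuadraticMap.polar (q (J.card + 1)) y e) 0 with hpolar | hpolar
  · obtain ⟨i, hi⟩ := hout.1
    exact hi.not_ge (hface e heJ hqe hpolar i)
  · obtain ⟨i, hi⟩ := hout.2
    refine hi.not_ge (hface (-e) (fun j hj => by simp [heJ j hj]) ?_ ?_ i)
    · rwa [QuadraticMap.map_neg]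
    · rw [QuadraticMap.polar_neg_right]
      exact neg_nonpos.2 hpolar

end ConeFaces

section QuadraticObjective

open Matrix (toEuclideanLin)

variable {d k : ℕ} {M : Matrix (Fin d) (Fin d) ℝ}

theorem quadForm_eq_inner (x : Euc d) : quadForm M x = 1 / 2 * ⟪toEuclideanLin M x, x⟫ := by
  rw [quadForm, real_inner_comm, ← Matrix.coe_toEuclideanCLM_eq_toEuclideanLin,
    ContinuousLinearMap.coe_coe, Matrix.inner_toEuclideanCLM]

theorem quadForm_smul (a : ℝ) (x : Euc d) : quadForm M (a • x) = a ^ 2 * quadForm M x := by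
  simp only [quadForm_eq_inner, map_smul, real_inner_smul_left, real_inner_smul_right]
  ring

theorem quadForm_neg (x : Euc d) : quadForm M (-x) = quadForm M x := by
  simpa using quadForm_smul (M := M) (-1) x

theorem quadForm_zero : quadForm M 0 = 0 := by
  simp [quadForm]

theorem abs_inner_toEuclideanLin_le (hM : M.IsHermitian) (x : Euc d) :
    |⟪toEuclideanLin M x, x⟫| ≤ lambdaAbsMax hM * ‖x‖ ^ 2 := by
  set b := hM.eigenvectorBasis
  have hcoord : ∀ i, ⟪toEuclideanLin M x, b i⟫ = hM.eigenvalues i * ⟪b i, x⟫ := fun i => by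
    have hbi : toEuclideanLin M (b i) = hM.eigenvalues i • b i :=
      WithLp.ofLp_injective 2 (hM.mulVec_eigenvectorBasis i)
    rw [Matrix.isSymmetric_toEuclideanLin_iff.2 hM x (b i), hbi, real_inner_smul_right,
      real_inner_comm]
  rw [← b.sum_inner_mul_inner]
  calc |∑ i, ⟪toEuclideanLin M x, b i⟫ * ⟪b i, x⟫|
      ≤ ∑ i, |⟪toEuclideanLin M x, b i⟫ * ⟪b i, x⟫| := Finset.abs_sum_le_sum_abs _ _
    _ = ∑ i, |hM.eigenvalues i| * ⟪b i, x⟫ ^ 2 := by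
        simp only [hcoord, mul_assoc, ← sq, abs_mul, abs_sq]
    _ ≤ ∑ i, lambdaAbsMax hM * ⟪b i, x⟫ ^ 2 := by
        gcongr with i
        exact le_ciSup (f := fun i => |hM.eigenvalues i|) (Set.finite_range _).bddAbove i
    _ = lambdaAbsMax hM * ‖x‖ ^ 2 := by rw [← Finset.mul_sum, b.sum_sq_inner_right]

theorem gradient_quadForm (hM : M.IsHermitian) (x : Euc d) :
    gradient (quadForm M) x = toEuclideanLin M x := by
  refine HasGradientAt.gradient (hasGradientAt_iff_hasFDerivAt.2 ?_)
  have h := (((Matrix.isSymmetric_toEuclideanLin_iff.2 hM).hasStrictFDerivAt_reApplyInnerSelf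
    (T := Matrix.toEuclideanCLM (𝕜 := ℝ) M) x).hasFDerivAt).const_mul (1 / 2)
  refine (h.congr_of_eventuallyEq (.of_forall quadForm_eq_inner)).congr_fderiv ?_
  ext y
  simpa using congrArg (⟪·, y⟫)
    (LinearMap.congr_fun (Matrix.coe_toEuclideanCLM_eq_toEuclideanLin M) x)

/-- The quadratic form `x ↦ f(x) - c ‖x‖²`. It is negative at `x ≠ 0` exactly when the normalised
value `f(x) / ‖x‖²` lies below `c`. -/
noncomputable def shiftedQuadForm (M : Matrix (Fin d) (Fin d) ℝ) (c : ℝ) :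
    QuadraticForm ℝ (Euc d) :=
  LinearMap.BilinMap.toQuadraticMap
    (innerₗ (Euc d) ∘ₗ ((1 / 2 : ℝ) • toEuclideanLin M - c • LinearMap.id))

theorem shiftedQuadForm_apply (c : ℝ) (x : Euc d) :
    shiftedQuadForm M c x = quadForm M x - c * ‖x‖ ^ 2 := by
  simp [shiftedQuadForm, quadForm_eq_inner]

/-- The linear functional `x ↦ A_iᵀ x` of the `i`-th constraint. -/
noncomputable def constraintFunctional (A : Matrix (Fin k) (Fin d) ℝ) (i : Fin k) :
    Euc d →ₗ[ℝ] ℝ :=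
  LinearMap.proj i ∘ₗ A.mulVecLin ∘ₗ (WithLp.linearEquiv 2 ℝ (Fin d → ℝ)).toLinearMap

theorem mem_cornerCone_zero {A : Matrix (Fin k) (Fin d) ℝ} {x : Euc d} :
    x ∈ cornerCone A 0 ↔ ∀ i, constraintFunctional A i x ≤ 0 := by
  simp only [cornerCone, sub_zero]
  rfl

theorem mem_activeDirections {A : Matrix (Fin k) (Fin d) ℝ} {I : Finset (Fin k)} {x : Euc d} :
    x ∈ activeDirections A I ↔ ∀ i ∈ I, constraintFunctional A i x = 0 :=
  Iff.rfl

theorem exists_maximal_activeDirections (A : Matrix (Fin k) (Fin d) ℝ) {c : ℕ → ℝ}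
    (hc : Monotone c) {x : Euc d} (hx : x ∈ cornerCone A 0)
    (hfx : quadForm M x < c 0 * ‖x‖ ^ 2) :
    ∃ J : Finset (Fin k), (∃ y ∈ activeDirections A J, quadForm M y < c J.card * ‖y‖ ^ 2) ∧
      ∀ e ∈ activeDirections A J, quadForm M e < c (J.card + 1) * ‖e‖ ^ 2 →
        e ∈ cornerCone A 0 ∨ -e ∈ cornerCone A 0 := by
  have hmono : ∀ n v, shiftedQuadForm M (c (n + 1)) v ≤ shiftedQuadForm M (c n) v := fun n v => by
    rw [shiftedQuadForm_apply, shiftedQuadForm_apply]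
    gcongr
    exact hc n.le_succ
  have hJ := exists_maximal_face (q := fun n => shiftedQuadForm M (c n)) hmono
    (mem_cornerCone_zero.1 hx) (by rwa [shiftedQuadForm_apply, sub_neg])
  simpa only [shiftedQuadForm_apply, sub_neg, ← mem_cornerCone_zero, ← mem_activeDirections]
    using hJ

end QuadraticObjective

namespace OracleProg

variable {d : ℕ} {α β : Type} (f : Euc d → ℝ)

theorem eval_bind (p : OracleProg (Euc d) α) (q : α → OracleProg (Euc d) β) :
    (p.bind q).eval f = (q (p.eval f)).eval f := by
  induction p with
  | ret a => rfl
  | grad _ _ ih => exact ih _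
  | value _ _ ih => exact ih _

theorem gradCalls_bind (p : OracleProg (Euc d) α) (q : α → OracleProg (Euc d) β) :
    (p.bind q).gradCalls f = p.gradCalls f + (q (p.eval f)).gradCalls f := by
  induction p with
  | ret a => exact (Nat.zero_add _).symm
  | grad x next ih => simp only [bind, gradCalls, eval, ih, add_right_comm]
  | value _ _ ih => exact ih _

end OracleProg

section Search

variable {d k : ℕ} (f : Euc d → ℝ) (x : Euc d)

section OracleCalls

variable (r η : ℝ) (T : ℕ)

theorem gradCalls_powerLoop (𝒜 : AffineSubspace ℝ (Euc d)) [Nonempty 𝒜] (z : Euc d) :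
    (powerLoop x 𝒜 η T z).gradCalls f = 2 * T := by
  induction T generalizing z with
  | zero => rfl
  | succ T ih => simp only [powerLoop, OracleProg.gradCalls, ih, mul_add_one]

theorem gradCalls_findInsideCorner (𝒜 : AffineSubspace ℝ (Euc d)) [Nonempty 𝒜] (ζ : Euc d) :
    (findInsideCorner x 𝒜 r η T ζ).gradCalls f = 2 * T := by
  rw [findInsideCorner, OracleProg.gradCalls_bind, gradCalls_powerLoop]
  rfl

theorem gradCalls_houdiniEscapeCorner_le (A : Matrix (Fin k) (Fin d) ℝ) (δ : ℝ)
    (noise : Finset (Fin k) → Euc d) (l : List (Finset (Fin k))) :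
    (houdiniEscapeCorner x A δ r η T noise l).gradCalls f ≤ 2 * T * l.length := by
  induction l with
  | nil => exact Nat.zero_le _
  | cons I rest ih =>
    rw [houdiniEscapeCorner, OracleProg.gradCalls_bind, gradCalls_findInsideCorner,
      List.length_cons, mul_add_one, add_comm]
    refine Nat.add_le_add_right ?_ _
    simp only [OracleProg.gradCalls]
    split_ifs
    · exact Nat.zero_le _
    · simp only [OracleProg.gradCalls]
      split_ifs
      · exact Nat.zero_le _
      · exact ih

end OracleCalls

/-- The test of the search: `y` lies in the cone with corner `x` and improves on `f x` by more than
`δ / 2`. -/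
def IsEscape (A : Matrix (Fin k) (Fin d) ℝ) (δ : ℝ) (y : Euc d) : Prop :=
  y ∈ cornerCone A x ∧ f y < f x - δ / 2

variable {f x}

theorem norm_findInsideCorner_eval_le (𝒜 : AffineSubspace ℝ (Euc d)) [Nonempty 𝒜] {r : ℝ}
    (hr : 0 ≤ r) (η : ℝ) (T : ℕ) (ζ : Euc d) : ‖(findInsideCorner x 𝒜 r η T ζ).eval f‖ ≤ r := by
  simp only [findInsideCorner, OracleProg.eval_bind, OracleProg.eval, norm_smul, norm_div,
    norm_norm, Real.norm_of_nonneg hr]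
  rw [div_mul_eq_mul_div, mul_div_assoc]
  exact mul_le_of_le_one_right hr (div_self_le_one _)

theorem exists_houdiniEscapeCorner_eval_eq_some {A : Matrix (Fin k) (Fin d) ℝ} {δ r : ℝ}
    (hr : 0 ≤ r) {η : ℝ} {T : ℕ} {noise : Finset (Fin k) → Euc d} {l : List (Finset (Fin k))}
    {I : Finset (Fin k)} (hI : I ∈ l)
    (h : IsEscape f x A δ (x + (findInsideCorner x (activeSubspace A x I) r η T (noise I)).eval f) ∨
      IsEscape f x A δ (x - (findInsideCorner x (activeSubspace A x I) r η T (noise I)).eval f)) :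
    ∃ y ∈ Metric.closedBall x r, IsEscape f x A δ y ∧
      (houdiniEscapeCorner x A δ r η T noise l).eval f = some y := by
  induction l with
  | nil => exact absurd hI List.not_mem_nil
  | cons I' rest ih =>
    have hnorm := norm_findInsideCorner_eval_le (f := f) (x := x) (activeSubspace A x I') hr η T
      (noise I')
    simp only [houdiniEscapeCorner, OracleProg.eval_bind, OracleProg.eval]
    split_ifs with hplus
    · exact ⟨_, by simpa using hnorm, hplus, rfl⟩
    simp only [OracleProg.eval]
    split_ifs with hminus
    · exact ⟨_, by simpa [dist_eq_norm] using hnorm, hminus, rfl⟩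
    refine ih ((List.mem_cons.1 hI).resolve_left ?_)
    rintro rfl
    exact h.elim hplus hminus

theorem proj_mk' (V : Submodule ℝ (Euc d)) (z : Euc d) :
    proj (AffineSubspace.mk' x V) (x + z) = x + V.starProjection z := by
  rw [proj, EuclideanGeometry.coe_orthogonalProjection_eq_iff_mem]
  simp [AffineSubspace.mem_mk', V.sub_starProjection_mem_orthogonal z]

variable {m : Euc d →ₗ[ℝ] Euc d}

theorem powerLoop_eval (hf : ∀ z, gradient f (x + z) - gradient f x = m z) (η : ℝ)
    (V : Submodule ℝ (Euc d)) (T : ℕ) {z : Euc d} (hz : z ∈ V) :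
    (powerLoop x (AffineSubspace.mk' x V) η T (x + z)).eval f =
      x + (projectedStep m η V ^ T) z := by
  induction T generalizing z with
  | zero => rfl
  | succ T ih =>
    simp only [powerLoop, OracleProg.eval, hf]
    rw [add_sub_assoc, proj_mk', ← projectedStep_apply_of_mem hz,
      ih (projectedStep_apply_mem z), pow_succ, Module.End.mul_apply]

theorem findInsideCorner_eval (hf : ∀ z, gradient f (x + z) - gradient f x = m z) (r η : ℝ)
    (V : Submodule ℝ (Euc d)) (T : ℕ) (ζ : Euc d) :
    (findInsideCorner x (AffineSubspace.mk' x V) r η T ζ).eval f =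
      (r / ‖(projectedStep m η V ^ T) (V.starProjection ζ)‖) •
        (projectedStep m η V ^ T) (V.starProjection ζ) := by
  simp only [findInsideCorner, OracleProg.eval_bind, OracleProg.eval, proj_mk',
    powerLoop_eval hf η V T (V.starProjection_apply_mem ζ), add_sub_cancel_left]

end Search

section Guarantee

open Matrix (toEuclideanLin)

variable {d k : ℕ} {M : Matrix (Fin d) (Fin d) ℝ} {L δ r ξ : ℝ}

theorem IsQCSP.two_mul_lt {S : Set (Euc d)} (hq : IsQCSP (quadForm M) S δ r) (hM : M.IsHermitian)
    (hML : lambdaAbsMax hM ≤ L) : 2 * δ < L * r ^ 2 := by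
  obtain ⟨x, ⟨hxr, -⟩, hfx⟩ := hq
  have hL : 0 ≤ L := (Real.iSup_nonneg fun _ => abs_nonneg _).trans hML
  have hbound := (neg_abs_le _).trans' (neg_le_neg (abs_inner_toEuclideanLin_le hM x))
  calc 2 * δ < lambdaAbsMax hM * ‖x‖ ^ 2 := by
        rw [quadForm_eq_inner] at hfx
        linarith
    _ ≤ L * r ^ 2 := by
        gcongr
        exact mem_closedBall_zero_iff.1 hxr

theorem IsQCSP.dim_pos {S : Set (Euc d)} (hq : IsQCSP (quadForm M) S δ r) (hδ : 0 < δ) :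
    0 < d := by
  obtain ⟨x, -, hfx⟩ := hq
  refine Nat.pos_of_ne_zero ?_
  rintro rfl
  rw [Subsingleton.elim x 0, quadForm_zero] at hfx
  linarith

theorem exists_unit_forall_quadForm_findInsideCorner_lt (hM : M.IsHermitian) (hL : 0 < L)
    (hML : lambdaAbsMax hM ≤ L) {c : ℝ} (hc : c ≤ 0) {V : Submodule ℝ (Euc d)} {y : Euc d}
    (hyV : y ∈ V) (hfy : quadForm M y < c * ‖y‖ ^ 2) (hr : 0 < r) {Λ : ℝ} (hΛ : 0 ≤ Λ) {T : ℕ}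
    (hT : T ≠ 0) :
    ∃ u : Euc d, ‖u‖ = 1 ∧ ∀ ζ, Real.exp (-Λ) * ‖ζ‖ ^ 2 < ⟪u, ζ⟫ ^ 2 → ∃ e ∈ V,
      (findInsideCorner 0 (AffineSubspace.mk' 0 V) r (1 / L) T ζ).eval (quadForm M) = e ∧
        ‖e‖ = r ∧ quadForm M e < (c + L * Λ / (2 * T)) * r ^ 2 := by
  have hmL : ∀ x, |⟪toEuclideanLin M x, x⟫| ≤ L * ‖x‖ ^ 2 := fun x =>
    (abs_inner_toEuclideanLin_le hM x).trans (by gcongr)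
  rw [quadForm_eq_inner] at hfy
  obtain ⟨u, hu1, hu⟩ := exists_unit_forall_inner_projectedStep_pow_lt (c := 2 * c)
    (Matrix.isSymmetric_toEuclideanLin_iff.2 hM) hL hmL (by linarith) hyV (by linarith) hΛ hT
  refine ⟨u, hu1, fun ζ hζ => ?_⟩
  have hw := hu ζ hζ
  have heval := findInsideCorner_eval (f := quadForm M) (x := 0) (m := toEuclideanLin M)
    (fun z => by simp only [gradient_quadForm hM, zero_add, map_zero, sub_zero]) r (1 / L) V T ζ
  have hwV := projectedStep_pow_mem (m := toEuclideanLin M) (η := 1 / L) T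
    (V.starProjection_apply_mem ζ)
  set w := (projectedStep (toEuclideanLin M) (1 / L) V ^ T) (V.starProjection ζ)
  have hw0 : 0 < ‖w‖ := norm_pos_iff.2 fun h => by simp [h] at hw
  refine ⟨(r / ‖w‖) • w, V.smul_mem _ hwV, heval, ?_, ?_⟩
  · rw [norm_smul, norm_div, norm_norm, div_mul_cancel₀ _ hw0.ne', Real.norm_of_nonneg hr.le]
  · calc quadForm M ((r / ‖w‖) • w)
        = (r / ‖w‖) ^ 2 * (1 / 2 * ⟪toEuclideanLin M w, w⟫) := by
          rw [quadForm_smul, quadForm_eq_inner]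
      _ < (r / ‖w‖) ^ 2 * (1 / 2 * ((2 * c + L * Λ / T) * ‖w‖ ^ 2)) := by gcongr
      _ = (c + L * Λ / (2 * T)) * r ^ 2 := by field_simp

/-- The bound on the normalised value `f(x) / ‖x‖²` that qualifies a point of a face with `n` active
constraints as good. It starts at `-δ / r²` and rises in equal steps to `-δ / (2 r²)` at
`n = k + 1`, so that each additional active constraint may lose one step. -/
noncomputable def threshold (k : ℕ) (δ r : ℝ) (n : ℕ) : ℝ :=
  (-δ + n * (δ / (2 * (k + 1)))) / r ^ 2

theorem threshold_monotone (k : ℕ) (hδ : 0 ≤ δ) (r : ℝ) : Monotone (threshold k δ r) :=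
  fun m n hmn => by
    unfold threshold
    gcongr

theorem threshold_succ (k : ℕ) (δ r : ℝ) (n : ℕ) :
    threshold k δ r (n + 1) = threshold k δ r n + δ / (2 * (k + 1)) / r ^ 2 := by
  unfold threshold
  push_cast
  ring

theorem threshold_mul_sq_le (hδ : 0 ≤ δ) (hr : r ≠ 0) {n : ℕ} (hn : n ≤ k + 1) :
    threshold k δ r n * r ^ 2 ≤ -(δ / 2) :=
  calc threshold k δ r n * r ^ 2 ≤ threshold k δ r (k + 1) * r ^ 2 := by
        gcongr
        exact threshold_monotone k hδ r hn
    _ = -δ + (k + 1 : ℕ) * (δ / (2 * (k + 1))) := div_mul_cancel₀ _ (pow_ne_zero 2 hr)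
    _ = -(δ / 2) := by
        push_cast
        field_simp
        norm_num

theorem threshold_nonpos (hδ : 0 ≤ δ) {n : ℕ} (hn : n ≤ k + 1) : threshold k δ r n ≤ 0 := by
  rcases eq_or_ne r 0 with rfl | hr
  · simp [threshold]
  · exact nonpos_of_mul_nonpos_left ((threshold_mul_sq_le hδ hr hn).trans (by linarith))
      (by positivity)

theorem threshold_add_le_threshold_succ (hr : 0 < r) {Λ : ℝ} {T : ℕ} (hT : T ≠ 0)
    (hTΛ : L * r ^ 2 * Λ * (k + 1) ≤ δ * T) (n : ℕ) :
    threshold k δ r n + L * Λ / (2 * T) ≤ threshold k δ r (n + 1) := by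
  rw [threshold_succ, add_le_add_iff_left, div_le_div_iff₀ (by positivity) (by positivity),
    div_mul_eq_mul_div, le_div_iff₀ (by positivity)]
  linarith

theorem exists_unit_forall_isEscape (hM : M.IsHermitian) (hδ : 0 < δ) (hr : 0 < r) (hL : 0 < L)
    (hML : lambdaAbsMax hM ≤ L) {A : Matrix (Fin k) (Fin d) ℝ}
    (hq : IsQCSP (quadForm M) (cornerCone A 0) δ r) {Λ : ℝ} (hΛ : 0 ≤ Λ) {T : ℕ} (hT : T ≠ 0)
    (hTΛ : L * r ^ 2 * Λ * (k + 1) ≤ δ * T) :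
    ∃ (J : Finset (Fin k)) (u : Euc d), ‖u‖ = 1 ∧
      ∀ ζ, Real.exp (-Λ) * ‖ζ‖ ^ 2 < ⟪u, ζ⟫ ^ 2 →
        IsEscape (quadForm M) 0 A δ
          (0 + (findInsideCorner 0 (activeSubspace A 0 J) r (1 / L) T ζ).eval (quadForm M)) ∨
        IsEscape (quadForm M) 0 A δ
          (0 - (findInsideCorner 0 (activeSubspace A 0 J) r (1 / L) T ζ).eval (quadForm M)) := by
  obtain ⟨x, ⟨hxr, hx⟩, hfx⟩ := hq
  have hfx0 : quadForm M x < threshold k δ r 0 * ‖x‖ ^ 2 := hfx.trans_le <|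
    calc -δ = threshold k δ r 0 * r ^ 2 := by simp [threshold, hr.ne']
      _ ≤ threshold k δ r 0 * ‖x‖ ^ 2 := by
        refine mul_le_mul_of_nonpos_left ?_ (threshold_nonpos hδ.le (Nat.zero_le _))
        gcongr
        exact mem_closedBall_zero_iff.1 hxr
  obtain ⟨J, ⟨y, hyJ, hfy⟩, hJ⟩ :=
    exists_maximal_activeDirections A (threshold_monotone k hδ.le r) hx hfx0
  have hcard : J.card + 1 ≤ k + 1 := Nat.succ_le_succ (card_finset_fin_le J)
  obtain ⟨u, hu1, hu⟩ := exists_unit_forall_quadForm_findInsideCorner_lt hM hL hML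
    (threshold_nonpos hδ.le (Nat.le_of_succ_le hcard)) hyJ hfy hr hΛ hT
  refine ⟨J, u, hu1, fun ζ hζ => ?_⟩
  obtain ⟨e, heJ, heval, her, hfe⟩ := hu ζ hζ
  replace hfe : quadForm M e < threshold k δ r (J.card + 1) * r ^ 2 := hfe.trans_le (by
    gcongr
    exact threshold_add_le_threshold_succ hr hT hTΛ _)
  have hescape : quadForm M e < quadForm M 0 - δ / 2 := by
    rw [quadForm_zero, zero_sub]
    exact hfe.trans_le (threshold_mul_sq_le hδ.le hr.ne' hcard)
  rw [heval, zero_add, zero_sub]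
  exact (hJ e heJ (her ▸ hfe)).imp (⟨·, hescape⟩) (⟨·, by rwa [quadForm_neg]⟩)

/-- The number `T` of iterations of the power method for each set of constraints. The factor `3` is
the exponent in `exp (-3 log (2 d / ξ)) = (ξ / (2 d))³ ≤ ξ³ / (8 d)`. -/
noncomputable def houdiniIterations (d k : ℕ) (L δ r ξ : ℝ) : ℕ :=
  ⌈3 * (L * r ^ 2 * (k + 1) / δ * Real.log (2 * d / ξ))⌉₊

theorem exp_neg_three_mul_log_le (hd : 0 < d) (hξ : 0 < ξ) :
    Real.exp (-(3 * Real.log (2 * d / ξ))) ≤ ξ ^ 3 / (8 * d) := by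
  have hd1 : (1 : ℝ) ≤ d := by exact_mod_cast hd
  calc Real.exp (-(3 * Real.log (2 * d / ξ))) = (ξ / (2 * d)) ^ 3 := by
        rw [← mul_neg, ← Real.log_inv, inv_div, ← Nat.cast_ofNat (n := 3), Real.exp_nat_mul,
          Real.exp_log (by positivity)]
    _ = ξ ^ 3 / (8 * d ^ 3) := by ring
    _ ≤ ξ ^ 3 / (8 * d) := by
        gcongr
        exact le_self_pow₀ hd1 three_ne_zero

theorem half_lt_log_two_mul_div (hd : 0 < d) (hξ : 0 < ξ) (hξ1 : ξ < 1) :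
    1 / 2 < Real.log (2 * d / ξ) := by
  have hd1 : (1 : ℝ) ≤ d := by exact_mod_cast hd
  have hlog : Real.log 2 ≤ Real.log (2 * d / ξ) := by
    gcongr
    rw [le_div_iff₀ hξ]
    gcongr
    exact hξ1.le.trans hd1
  linarith [Real.log_two_gt_d9]

theorem houdiniIterations_pos (hd : 0 < d) (hδ : 0 < δ) (hr : 0 < r) (hL : 0 < L) (hξ : 0 < ξ)
    (hξ1 : ξ < 1) : 0 < houdiniIterations d k L δ r ξ := by
  have hlog := one_half_pos.trans (half_lt_log_two_mul_div hd hξ hξ1)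
  exact Nat.ceil_pos.2 (by positivity)

theorem mul_le_mul_houdiniIterations (hδ : 0 < δ) :
    L * r ^ 2 * (3 * Real.log (2 * d / ξ)) * (k + 1) ≤ δ * houdiniIterations d k L δ r ξ := by
  rw [← div_le_iff₀' hδ]
  refine (Nat.le_ceil _).trans' (le_of_eq ?_)
  ring

theorem houdiniIterations_le (hd : 0 < d) (hδ : 0 < δ) (hLr : 2 * δ < L * r ^ 2) (hξ : 0 < ξ)
    (hξ1 : ξ < 1) :
    houdiniIterations d k L δ r ξ ≤ 4 * (L * r ^ 2 * (k + 1) / δ * Real.log (2 * d / ξ)) := by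
  have hlog := half_lt_log_two_mul_div hd hξ hξ1
  have hratio : 2 ≤ L * r ^ 2 * (k + 1) / δ := by
    rw [le_div_iff₀ hδ]
    exact hLr.le.trans (le_mul_of_one_le_right (by linarith) (by simp))
  have hone : 1 ≤ L * r ^ 2 * (k + 1) / δ * Real.log (2 * d / ξ) :=
    calc (1 : ℝ) = 2 * (1 / 2) := by norm_num
      _ ≤ _ := by gcongr
  have hceil := Nat.ceil_lt_add_one
    (by linarith : 0 ≤ 3 * (L * r ^ 2 * (k + 1) / δ * Real.log (2 * d / ξ)))
  rw [houdiniIterations]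
  linarith

theorem two_mul_houdiniIterations_mul_le (hd : 0 < d) (hδ : 0 < δ) (hLr : 2 * δ < L * r ^ 2)
    (hξ : 0 < ξ) (hξ1 : ξ < 1) :
    2 * (houdiniIterations d k L δ r ξ : ℝ) * 2 ^ k ≤
      16 * (L * r ^ 2 * (max k 1 : ℕ) * 2 ^ k / δ) * Real.log (2 * d / ξ) := by
  have hlog := one_half_pos.trans (half_lt_log_two_mul_div hd hξ hξ1)
  have hLr0 : 0 < L * r ^ 2 := by linarith
  have hk : (k : ℝ) + 1 ≤ 2 * (max k 1 : ℕ) := by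
    exact_mod_cast (by lia : k + 1 ≤ 2 * max k 1)
  calc 2 * (houdiniIterations d k L δ r ξ : ℝ) * 2 ^ k
      ≤ 2 * (4 * (L * r ^ 2 * (k + 1) / δ * Real.log (2 * d / ξ))) * 2 ^ k := by
        gcongr
        exact houdiniIterations_le hd hδ hLr hξ hξ1
    _ ≤ 2 * (4 * (L * r ^ 2 * (2 * (max k 1 : ℕ)) / δ * Real.log (2 * d / ξ))) * 2 ^ k := by
        gcongr
    _ = 16 * (L * r ^ 2 * (max k 1 : ℕ) * 2 ^ k / δ) * Real.log (2 * d / ξ) := by ring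

theorem le_measure_houdiniEscapeCorner (hM : M.IsHermitian) (hδ : 0 < δ) (hr : 0 < r) (hL : 0 < L)
    (hξ : 0 < ξ) (hξ1 : ξ < 1) (hML : lambdaAbsMax hM ≤ L) {A : Matrix (Fin k) (Fin d) ℝ}
    (hq : IsQCSP (quadForm M) (cornerCone A 0) δ r) {order : List (Finset (Fin k))}
    (hmem : ∀ I, I ∈ order) {P : Measure (Finset (Fin k) → Euc d)}
    (hP : ∀ I, MeasurePreserving (Function.eval I) P (stdGaussian (Euc d))) :
    ENNReal.ofReal (1 - ξ) ≤ P
      {noise | ∃ y ∈ cornerCone A 0 ∩ Metric.closedBall (0 : Euc d) r,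
        (houdiniEscapeCorner 0 A δ r (1 / L) (houdiniIterations d k L δ r ξ) noise order).eval
          (quadForm M) = some y ∧ quadForm M y < -(δ / 2)} := by
  have hd := hq.dim_pos hδ
  have hlog := one_half_pos.trans (half_lt_log_two_mul_div hd hξ hξ1)
  obtain ⟨J, u, hu1, hu⟩ := exists_unit_forall_isEscape hM hδ hr hL hML hq
    (Λ := 3 * Real.log (2 * d / ξ)) (by positivity)
    (houdiniIterations_pos hd hδ hr hL hξ hξ1).ne' (mul_le_mul_houdiniIterations hδ)
  set good : Set (Euc d) := {ζ | ξ ^ 3 / (8 * d) * ‖ζ‖ ^ 2 < ⟪u, ζ⟫ ^ 2}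
  have hgood : MeasurableSet good := measurableSet_lt (by fun_prop) (by fun_prop)
  calc ENNReal.ofReal (1 - ξ) ≤ stdGaussian (Euc d) good := by
        simpa only [finrank_euclideanSpace_fin] using le_stdGaussian_mul_norm_sq_lt_inner_sq hu1 hξ
    _ = P (Function.eval J ⁻¹' good) := ((hP J).measure_preimage hgood.nullMeasurableSet).symm
    _ ≤ _ := measure_mono fun noise hnoise => ?_
  have hescape := hu (noise J) (hnoise.trans_le' (by
    gcongr
    exact exp_neg_three_mul_log_le hd hξ))
  obtain ⟨y, hyr, ⟨hyA, hfy⟩, heval⟩ :=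
    exists_houdiniEscapeCorner_eval_eq_some hr.le (hmem J) hescape
  refine ⟨y, ⟨hyA, hyr⟩, heval, ?_⟩
  rwa [quadForm_zero, zero_sub] at hfy

end Guarantee

theorem theorem2_general :
    ∃ C : ℝ, 0 < C ∧
      ∀ (d k : ℕ) (L δ r ξ : ℝ), 0 < δ → 0 < r → 0 < ξ → ξ < 1 →
        ∃ T : ℕ,
          ∀ (M : Matrix (Fin d) (Fin d) ℝ) (hM : M.IsHermitian) (A : Matrix (Fin k) (Fin d) ℝ)
            (order : List (Finset (Fin k))),
            lambdaAbsMax hM ≤ L →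
            order.Nodup → (∀ I : Finset (Fin k), I ∈ order) →
            IsQCSP (quadForm M) (cornerCone A 0) δ r →
              (∀ P : Measure (Finset (Fin k) → Euc d),
                (∀ I, MeasurePreserving (Function.eval I) P (stdGaussian (Euc d))) →
                ENNReal.ofReal (1 - ξ) ≤ P
                  {noise | ∃ y ∈ cornerCone A 0 ∩ Metric.closedBall (0 : Euc d) r,
                    (houdiniEscapeCorner 0 A δ r (1 / L) T noise order).eval (quadForm M) = some y ∧
                    quadForm M y < -(δ / 2)}) ∧
              ∀ noise : Finset (Fin k) → Euc d,
                (((houdiniEscapeCorner 0 A δ r (1 / L) T noise order).gradCalls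
                    (quadForm M) : ℕ) : ℝ) ≤
                  C * (L * r ^ 2 * (max k 1 : ℕ) * 2 ^ k / δ) * Real.log (2 * d / ξ) := by
  refine ⟨16, by norm_num, fun d k L δ r ξ hδ hr hξ hξ1 => ⟨houdiniIterations d k L δ r ξ, ?_⟩⟩
  intro M hM A order hML hnodup hmem hq
  have hLr := hq.two_mul_lt hM hML
  have hL : 0 < L := pos_of_mul_pos_left (hLr.trans' (by positivity)) (sq_nonneg r)
  refine ⟨fun P => le_measure_houdiniEscapeCorner hM hδ hr hL hξ hξ1 hML hq hmem, fun noise => ?_⟩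
  have hlength : order.length ≤ 2 ^ k := by simpa using hnodup.length_le_card
  have hcalls := (gradCalls_houdiniEscapeCorner_le (quadForm M) 0 r (1 / L)
    (houdiniIterations d k L δ r ξ) A δ noise order).trans (Nat.mul_le_mul_left _ hlength)
  exact (by exact_mod_cast hcalls : _ ≤ 2 * (houdiniIterations d k L δ r ξ : ℝ) * 2 ^ k).trans
    (two_mul_houdiniIterations_mul_le (hq.dim_pos hδ) hδ hLr hξ hξ1)

theorem theorem2 :
    ∃ C : ℝ, 0 < C ∧
      ∀ (d k : ℕ) (L δ r ξ : ℝ), 0 < δ → 0 < r → 0 < ξ → ξ < 1 →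
        ∃ T : ℕ,
          ∀ (M : Matrix (Fin d) (Fin d) ℝ) (hM : M.IsHermitian) (A : Matrix (Fin k) (Fin d) ℝ)
            (order : List (Finset (Fin k))),
            lambdaAbsMax hM ≤ L →
            order.Nodup → (∀ I : Finset (Fin k), I ∈ order) →
            IsQCSP (quadForm M) (cornerCone A 0) δ r →
              ENNReal.ofReal (1 - ξ) ≤ noiseLaw d k
                {noise | ∃ y ∈ cornerCone A 0 ∩ Metric.closedBall (0 : Euc d) r,
                  (houdiniEscapeCorner 0 A δ r (1 / L) T noise order).eval (quadForm M) = some y ∧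
                  quadForm M y < -(δ / 2)} ∧
              ∀ noise : Finset (Fin k) → Euc d,
                (((houdiniEscapeCorner 0 A δ r (1 / L) T noise order).gradCalls
                    (quadForm M) : ℕ) : ℝ) ≤
                  C * (L * r ^ 2 * (max k 1 : ℕ) * 2 ^ k / δ) * Real.log (2 * d / ξ) := by
  obtain ⟨C, hC, h⟩ := theorem2_general
  exact ⟨C, hC, fun d k L δ r ξ hδ hr hξ hξ1 => (h d k L δ r ξ hδ hr hξ hξ1).imp
    fun T hT M hM A order hML hnodup hmem hq => (hT M hM A order hML hnodup hmem hq).imp_left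
      fun hP => hP _ fun I => measurePreserving_eval (fun _ => stdGaussian (Euc d)) I⟩
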